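/- Setting. Let $\delta\in(0,1)$ be a discount factor, $x_0>0$ an outside option, and $X\subset\mathbb R_+$ a Borel set of alternatives with $0\in X$. Let $\mathcal F_X$ be the set of all probability distributions ("environments") on $X$ with finite mean. A history is a finite sequence $h=(x_0,x_1,\dots,x_t)$, $t\ge 0$, starting with the outside option; its best-so-far alternative is $y(h)=\max\{x_0,\dots,x_t\}$. A decision rule $p$ assigns (measurably) to each history $h$ a probability $p(h)\in[0,1]$ of stopping after $h$; stopping after $s$ further rounds at a history with best-so-far alternative $y$ is worth $\delta^s y$, and never stopping is worth $0$. A prior $\mu$ is a probability distribution with finite support on $\mathcal F_X$; first $F$ is drawn from $\mu$, and then $x_1,x_2,\dots$ are drawn i.i.d. from $F$. A prior is consistent with $h=(x_0,\dots,x_t)$ if the draws $x_1,\dots,x_t$ occur with positive probability under $\mu$. For such $\mu$ and $h$, let $U_p(\mu,h)$ be the expected payoff of rule $p$ conditional on having reached $h$ (environments being weighted by their posterior probabilities given $h$ by Bayes' rule), and let $V(\mu,h)=\sup_p U_p(\mu,h)$ be the Bayes-optimal payoff. The performance ratio of $p$ is \[ R_p(x_0,\mathcal F_X)=\inf_{h}\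 \inf_{\mu}\ \frac{U_p(\mu,h)}{V(\mu,h)}, \] the infimum being over all histories $h$ with outside option $x_0$ and all priors $\mu$ consistent with $h$. Let $R^*(x_0,\mathcal F_X)=\sup_p R_p(x_0,\mathcal F_X)$; a rule $p^*$ is dynamically robust if $R_{p^*}(x_0,\mathcal F_X)=R^*(x_0,\mathcal F_X)$. Theorem. The stationary decision rule $\bar p$ that stops after every history with the constant probability $\frac{1-\delta}{2-\delta}$ (a) has performance ratio $R_{\bar p}(x_0,\mathcal F_X)\ge \frac14$; (b) is dynamically robust if $\sup X=\infty$; in that case $R^*(x_0,\mathcal F_X)=\frac14$, so that no decision rule guarantees more than $\frac14$. -/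

import Mathlib

open Set MeasureTheory
open scoped ENNReal

noncomputable section

/-! ### Sequential search with free recall

A history `h = (x₀, x₁, …, x_t)` is the nonempty list `[x₀, x₁, …, x_t]`: its head is the outside
option and its tail lists the alternatives drawn so far. -/

/-- The histories with outside option `x₀`. -/
def histories (x₀ : ℝ) : Set (List ℝ) :=
  {h | ∃ draws : List ℝ, h = x₀ :: draws}

/-- The best-so-far alternative `y_t = max {x₀, x₁, …, x_t}` (all values are nonnegative). -/
def bestSoFar (h : List ℝ) : ℝ :=
  h.foldr max 0

/-- A decision rule prescribes for each history the probability of stopping after it. As usual, it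
has to be a measurable function of the alternatives seen so far. -/
structure DecisionRule where
  /-- the probability of stopping after a history -/
  prob : List ℝ → ℝ
  prob_mem : ∀ h, prob h ∈ Icc (0 : ℝ) 1
  measurable_prob : ∀ n : ℕ, Measurable fun v : Fin n → ℝ => prob (List.ofFn v)

/-- The environments over a set `X` of alternatives: the Borel probability distributions on `ℝ`
that are concentrated on `X` and have a finite mean. -/
def environments (X : Set ℝ) : Set (ProbabilityMeasure ℝ) :=
  {F | (F : Measure ℝ) Xᶜ = 0 ∧ Integrable (fun x : ℝ => x) (F : Measure ℝ)}

/-- The priors (mixed environments) over a set `𝓕` of feasible environments: the probability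
distributions on `𝓕` with finite support. -/
def priors (𝓕 : Set (ProbabilityMeasure ℝ)) : Set (PMF (ProbabilityMeasure ℝ)) :=
  {μ | μ.support.Finite ∧ μ.support ⊆ 𝓕}

/-- The probability that the i.i.d. draws from `F` are the alternatives `x₁, …, x_t` of the history
`h = (x₀, x₁, …, x_t)`. -/
def likelihood (F : ProbabilityMeasure ℝ) (h : List ℝ) : ℝ≥0∞ :=
  (h.tail.map fun x => (F : Measure ℝ) {x}).prod

/-- The probability that the alternatives `x₁, …, x_t` of the history `h` occur under the prior
`μ`. -/
def evidence (μ : PMF (ProbabilityMeasure ℝ)) (h : List ℝ) : ℝ≥0∞ :=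
  ∑' F, μ F * likelihood F h

/-- The priors over `𝓕` that are consistent with the history `h`: those under which the
alternatives of `h` occur with positive probability. -/
def consistentPriors (𝓕 : Set (ProbabilityMeasure ℝ)) (h : List ℝ) :
    Set (PMF (ProbabilityMeasure ℝ)) :=
  {μ | μ ∈ priors 𝓕 ∧ 0 < evidence μ h}

/-- The posterior probability of the environment `F` given the history `h`, by Bayes' rule. -/
def posterior (μ : PMF (ProbabilityMeasure ℝ)) (h : List ℝ) (F : ProbabilityMeasure ℝ) : ℝ≥0∞ :=
  μ F * likelihood F h / evidence μ h

/-- The individual has reached the history `h`, and `d` lists the alternatives that come next.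
This is the probability that she continues until all of `d` has been drawn and stops right then,
times the discounted payoff `δ ^ |d| * y` which that gives her. -/
def discountedGain (δ : ℝ) (p : DecisionRule) (h d : List ℝ) : ℝ :=
  (∏ j ∈ Finset.range d.length, (1 - p.prob (h ++ d.take j))) * p.prob (h ++ d) *
    (δ ^ d.length * bestSoFar (h ++ d))

/-- The expected payoff of the rule `p` in the environment `F`, conditional on having reached the
history `h`: the sum, over the number `s` of additional rounds, of the expected discounted payoff
from stopping after exactly `s` more i.i.d. draws from `F`. Never stopping gives payoff `0`. -/
def envPayoff (δ : ℝ) (p : DecisionRule) (F : ProbabilityMeasure ℝ) (h : List ℝ) : ℝ≥0∞ :=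
  ∑' s : ℕ, ∫⁻ v : Fin s → ℝ, ENNReal.ofReal (discountedGain δ p h (List.ofFn v))
    ∂(Measure.pi fun _ : Fin s => (F : Measure ℝ))

/-- `U_p(μ, h)`: the expected payoff of the rule `p` under the prior `μ`, conditional on the
history `h`. -/
def payoff (δ : ℝ) (p : DecisionRule) (μ : PMF (ProbabilityMeasure ℝ)) (h : List ℝ) : ℝ≥0∞ :=
  ∑' F, posterior μ h F * envPayoff δ p F h

/-- `V(μ, h)`: the optimal (Bayesian) payoff under the prior `μ`, conditional on the history `h`. -/
def optimalPayoff (δ : ℝ) (μ : PMF (ProbabilityMeasure ℝ)) (h : List ℝ) : ℝ≥0∞ :=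
  ⨆ p : DecisionRule, payoff δ p μ h

/-- `R_p(x₀, 𝓕)`: the performance ratio of the rule `p`, the infimum of the payoff ratios
`U_p(μ, h) / V(μ, h)` over all histories `h` with outside option `x₀` and all priors `μ` over `𝓕`
that are consistent with `h`. -/
def performanceRatio (δ : ℝ) (p : DecisionRule) (x₀ : ℝ) (𝓕 : Set (ProbabilityMeasure ℝ)) :
    ℝ≥0∞ :=
  ⨅ h ∈ histories x₀, ⨅ μ ∈ consistentPriors 𝓕 h, payoff δ p μ h / optimalPayoff δ μ h

/-- `R^*(x₀, 𝓕)`: the dynamically robust performance ratio. -/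
def robustRatio (δ : ℝ) (x₀ : ℝ) (𝓕 : Set (ProbabilityMeasure ℝ)) : ℝ≥0∞ :=
  ⨆ p : DecisionRule, performanceRatio δ p x₀ 𝓕

/-- A rule is dynamically robust if it attains the dynamically robust performance ratio. -/
def IsDynamicallyRobust (δ : ℝ) (p : DecisionRule) (x₀ : ℝ)
    (𝓕 : Set (ProbabilityMeasure ℝ)) : Prop :=
  performanceRatio δ p x₀ 𝓕 = robustRatio δ x₀ 𝓕

/-- The stationary rule that stops with the constant probability `q`. -/
def constantRule (q : ℝ) (hq : q ∈ Icc (0 : ℝ) 1) : DecisionRule where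
  prob _ := q
  prob_mem _ := hq
  measurable_prob _ := measurable_const

theorem quarterProb_mem {δ : ℝ} (hδ : δ ∈ Ioo (0 : ℝ) 1) :
    (1 - δ) / (2 - δ) ∈ Icc (0 : ℝ) 1 := by
  obtain ⟨h0, h1⟩ := hδ
  constructor
  · exact div_nonneg (by linarith) (by linarith)
  · rw [div_le_one (by linarith)]
    linarith

end

noncomputable section

/-! Both bounds are proved one environment at a time.

Lower bound. Fix `F` and let `c` be its reservation value, `c = δ E max(c, x)`
(`exists_reservationValue`). With best-so-far alternative `y`, no rule earns more than `max y c`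
(`envPayoff_le`). The constant rule earns at least `y / 2`, and in fact at least `(y + max y c) /
4`, which is at least a quarter of that bound. Payoffs under a prior are posterior averages of
payoffs in known environments, so the factor 4 survives averaging, whatever the prior and the
history.

Upper bound. Given a rule, let `zeroRatio` at `h` be `E δ^τ`, with `τ` the number of rounds until it
stops if only zeros arrive, and let `a` be its supremum over histories with alternatives in `X`.
Consider an environment that yields a huge `z` with small probability `q`. Before stopping, the rule
makes `E (δ + ... + δ^τ) = δ (1 - zeroRatio) / (1 - δ)` discounted draws, and after finding `z` it
keeps about a fraction `a` of `z` at most. So it earns at most about `q z a δ (1 - zeroRatio) / (1 -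
δ)`, while waiting for `z` earns about `q z δ / (1 - δ)`. A guaranteed ratio `r` thus satisfies `r ≤
a (1 - zeroRatio)` at every history; letting `zeroRatio` approach `a` gives `r ≤ a (1 - a) ≤ 1/4`.
Unboundedness of `X` supplies `z`, and a negligible mixture component makes the past draws possible.
-/

theorem bestSoFar_nonneg (h : List ℝ) : 0 ≤ bestSoFar h := by
  induction h with
  | nil => simp [bestSoFar]
  | cons a l ih => exact le_max_of_le_right ih

theorem bestSoFar_append_singleton (h : List ℝ) (x : ℝ) :
    bestSoFar (h ++ [x]) = max (bestSoFar h) x := by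
  induction h with
  | nil => simp [bestSoFar, max_comm]
  | cons a l ih =>
    have e : ∀ m : List ℝ, bestSoFar (a :: m) = max a (bestSoFar m) := fun _ => rfl
    rw [List.cons_append, e, e, ih, max_assoc]

theorem le_bestSoFar {h : List ℝ} {x : ℝ} (hx : x ∈ h) : x ≤ bestSoFar h := by
  induction h with
  | nil => simp at hx
  | cons a l ih =>
    rcases List.mem_cons.1 hx with rfl | hx
    · exact le_max_left _ _
    · exact le_max_of_le_right (ih hx)

/-! ### Measurability of payoffs in the draws -/

section Measurability

variable {α : Type*} [MeasurableSpace α]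

/-- Representing a random history as a list of measurable functions lets fixed past entries
(constants) and future draws (coordinates) be handled together. -/
theorem DecisionRule.measurable_prob_map (p : DecisionRule) (l : List (α → ℝ))
    (hl : ∀ f ∈ l, Measurable f) : Measurable fun a => p.prob (l.map fun f => f a) := by
  have e : (fun a => p.prob (l.map fun f => f a)) =
      (fun v : Fin l.length → ℝ => p.prob (List.ofFn v)) ∘ fun a i => l.get i a := by
    funext a
    simp only [Function.comp]
    congr 1
    apply List.ext_getElem <;> simp
  rw [e]
  exact (p.measurable_prob _).comp (measurable_pi_lambda _ fun i => hl _ (List.get_mem _ _))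

theorem measurable_bestSoFar_map (l : List (α → ℝ)) (hl : ∀ f ∈ l, Measurable f) :
    Measurable fun a => bestSoFar (l.map fun f => f a) := by
  induction l with
  | nil => exact measurable_const
  | cons f l ih =>
    simp only [List.mem_cons, forall_eq_or_imp] at hl
    exact hl.1.max (ih hl.2)

theorem measurable_discountedGain_map (δ : ℝ) (p : DecisionRule) (l m : List (α → ℝ))
    (hl : ∀ f ∈ l, Measurable f) (hm : ∀ f ∈ m, Measurable f) :
    Measurable fun a =>
      discountedGain δ p (l.map fun f => f a) (m.map fun f => f a) := by
  have happ : ∀ f ∈ l ++ m, Measurable f := fun f hf =>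
    (List.mem_append.1 hf).elim (hl f) (hm f)
  simp only [discountedGain, List.length_map, ← List.map_take, ← List.map_append]
  refine ((Finset.measurable_prod _ fun j _ => ?_).mul (p.measurable_prob_map _ happ)).mul
    ((measurable_bestSoFar_map _ happ).const_mul _)
  refine (p.measurable_prob_map _ fun f hf => ?_).const_sub 1
  exact (List.mem_append.1 hf).elim (hl f) fun hf => hm f (List.mem_of_mem_take hf)

end Measurability

theorem measurable_discountedGain (δ : ℝ) (p : DecisionRule) (h : List ℝ) (s : ℕ) :
    Measurable fun v : Fin s → ℝ => discountedGain δ p h (List.ofFn v) := by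
  have := measurable_discountedGain_map δ p (h.map fun (c : ℝ) (_ : Fin s → ℝ) => c)
    (List.ofFn fun (i : Fin s) (v : Fin s → ℝ) => v i)
    (by simp only [List.mem_map]; rintro f ⟨c, -, rfl⟩; exact measurable_const)
    (by simp only [List.mem_ofFn]; rintro f ⟨i, rfl⟩; exact measurable_pi_apply i)
  simpa [List.map_ofFn, Function.comp_def] using this

theorem measurable_discountedGain_append (δ : ℝ) (p : DecisionRule) (h : List ℝ) (s : ℕ) :
    Measurable fun q : ℝ × (Fin s → ℝ) => discountedGain δ p (h ++ [q.1]) (List.ofFn q.2) := by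
  have := measurable_discountedGain_map δ p
    (h.map (fun (c : ℝ) (_ : ℝ × (Fin s → ℝ)) => c) ++ [Prod.fst])
    (List.ofFn fun (i : Fin s) (q : ℝ × (Fin s → ℝ)) => q.2 i)
    (by
      simp only [List.mem_append, List.mem_map, List.mem_singleton]
      rintro f (⟨c, -, rfl⟩ | rfl)
      · exact measurable_const
      · exact measurable_fst)
    (by
      simp only [List.mem_ofFn]
      rintro f ⟨i, rfl⟩
      exact (measurable_pi_apply i).comp measurable_snd)
  simpa [List.map_ofFn, Function.comp_def] using this

/-! ### One-step recursion for the payoff -/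

theorem discountedGain_nil (δ : ℝ) (p : DecisionRule) (h : List ℝ) :
    discountedGain δ p h [] = p.prob h * bestSoFar h := by
  simp [discountedGain]

theorem discountedGain_cons (δ : ℝ) (p : DecisionRule) (h d : List ℝ) (x : ℝ) :
    discountedGain δ p h (x :: d) =
      (1 - p.prob h) * δ * discountedGain δ p (h ++ [x]) d := by
  simp only [discountedGain, List.length_cons, Finset.prod_range_succ', List.take_succ_cons,
    List.take_zero, List.append_nil, List.append_assoc, List.singleton_append, pow_succ]
  ring

/-- The expected discounted payoff from stopping after exactly `s` more draws. -/
def stagePayoff (δ : ℝ) (p : DecisionRule) (F : ProbabilityMeasure ℝ) (s : ℕ) (h : List ℝ) :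
    ℝ≥0∞ :=
  ∫⁻ v : Fin s → ℝ, ENNReal.ofReal (discountedGain δ p h (List.ofFn v))
    ∂(Measure.pi fun _ : Fin s => (F : Measure ℝ))

theorem envPayoff_eq_tsum (δ : ℝ) (p : DecisionRule) (F : ProbabilityMeasure ℝ) (h : List ℝ) :
    envPayoff δ p F h = ∑' s, stagePayoff δ p F s h := rfl

theorem stagePayoff_zero (δ : ℝ) (p : DecisionRule) (F : ProbabilityMeasure ℝ) (h : List ℝ) :
    stagePayoff δ p F 0 h = ENNReal.ofReal (p.prob h * bestSoFar h) := by
  simp [stagePayoff, discountedGain_nil]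

theorem stagePayoff_succ {δ : ℝ} (hδ : 0 ≤ δ) (p : DecisionRule) (F : ProbabilityMeasure ℝ)
    (s : ℕ) (h : List ℝ) :
    stagePayoff δ p F (s + 1) h = ENNReal.ofReal ((1 - p.prob h) * δ) *
      ∫⁻ x, stagePayoff δ p F s (h ++ [x]) ∂(F : Measure ℝ) := by
  have hq : 0 ≤ (1 - p.prob h) * δ := mul_nonneg (by linarith [(p.prob_mem h).2]) hδ
  have hmp := (measurePreserving_piFinSuccAbove
    (fun _ : Fin (s + 1) => (F : Measure ℝ)) 0).symm
  have hm := measurable_discountedGain_append δ p h s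
  rw [stagePayoff, ← hmp.map_eq, lintegral_map_equiv, ← lintegral_const_mul]
  · rw [lintegral_prod]
    · refine lintegral_congr fun x => ?_
      rw [stagePayoff, ← lintegral_const_mul _ (measurable_discountedGain δ p _ s).ennreal_ofReal]
      refine lintegral_congr fun w => ?_
      rw [← ENNReal.ofReal_mul hq, ← discountedGain_cons]
      simp [MeasurableEquiv.piFinSuccAbove, List.ofFn_succ]
    · exact (ENNReal.measurable_ofReal.comp ((measurable_discountedGain δ p h (s + 1)).comp
        (MeasurableEquiv.measurable _))).aemeasurable
  · exact (ENNReal.measurable_ofReal.comp hm).lintegral_prod_right'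

theorem measurable_stagePayoff_append (δ : ℝ) (p : DecisionRule) (F : ProbabilityMeasure ℝ)
    (s : ℕ) (h : List ℝ) : Measurable fun x => stagePayoff δ p F s (h ++ [x]) :=
  (ENNReal.measurable_ofReal.comp
    (measurable_discountedGain_append δ p h s)).lintegral_prod_right'

theorem sum_stagePayoff_succ {δ : ℝ} (hδ : 0 ≤ δ) (p : DecisionRule) (F : ProbabilityMeasure ℝ)
    (n : ℕ) (h : List ℝ) :
    ∑ s ∈ Finset.range (n + 1), stagePayoff δ p F s h =
      ENNReal.ofReal (p.prob h * bestSoFar h) + ENNReal.ofReal ((1 - p.prob h) * δ) *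
        ∫⁻ x, ∑ s ∈ Finset.range n, stagePayoff δ p F s (h ++ [x]) ∂(F : Measure ℝ) := by
  rw [Finset.sum_range_succ', stagePayoff_zero, add_comm,
    lintegral_finsetSum _ fun s _ => measurable_stagePayoff_append δ p F s h, Finset.mul_sum]
  simp only [stagePayoff_succ hδ]

theorem envPayoff_eq {δ : ℝ} (hδ : 0 ≤ δ) (p : DecisionRule) (F : ProbabilityMeasure ℝ)
    (h : List ℝ) :
    envPayoff δ p F h =
      ENNReal.ofReal (p.prob h * bestSoFar h) + ENNReal.ofReal ((1 - p.prob h) * δ) *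
        ∫⁻ x, envPayoff δ p F (h ++ [x]) ∂(F : Measure ℝ) := by
  simp only [envPayoff_eq_tsum]
  rw [lintegral_tsum fun s => (measurable_stagePayoff_append δ p F s h).aemeasurable,
    tsum_eq_zero_add' ENNReal.summable, stagePayoff_zero, ← ENNReal.tsum_mul_left]
  simp only [stagePayoff_succ hδ]

/-! ### Optimal search in a known environment -/

/-- If `c` is at least the discounted value of one more draw with fallback `c`, then no rule is
worth more than `max y c` at best-so-far alternative `y`. -/
theorem envPayoff_le {δ : ℝ} (hδ : δ ∈ Ioo (0 : ℝ) 1) (p : DecisionRule)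
    (F : ProbabilityMeasure ℝ) {c : ℝ} (hc : 0 ≤ c)
    (hF : ENNReal.ofReal δ * ∫⁻ x, ENNReal.ofReal (max c x) ∂(F : Measure ℝ) ≤
      ENNReal.ofReal c) (h : List ℝ) :
    envPayoff δ p F h ≤ ENNReal.ofReal (max (bestSoFar h) c) := by
  -- The bound `max y c` is a supersolution of the one-step recursion: for `y ≥ c`, raising the
  -- fallback from `c` to `y` adds at most `y - c` to the continuation value.
  have key : ∀ y : ℝ, ENNReal.ofReal δ *
      ∫⁻ x, ENNReal.ofReal (max (max y x) c) ∂(F : Measure ℝ) ≤ ENNReal.ofReal (max y c) := by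
    intro y
    rcases le_total y c with hy | hy
    · rw [max_eq_right hy]
      refine le_trans (le_of_eq ?_) hF
      congr 1
      refine lintegral_congr fun x => ?_
      rw [max_right_comm, max_eq_right hy]
    · rw [max_eq_left hy]
      calc ENNReal.ofReal δ * ∫⁻ x, ENNReal.ofReal (max (max y x) c) ∂(F : Measure ℝ)
          ≤ ENNReal.ofReal δ *
            ∫⁻ x, (ENNReal.ofReal (max c x) + ENNReal.ofReal (y - c)) ∂(F : Measure ℝ) := by
            gcongr with x
            rw [← ENNReal.ofReal_add (le_max_of_le_left hc) (by linarith)]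
            apply ENNReal.ofReal_le_ofReal
            have := le_max_left c x
            have := le_max_right c x
            exact max_le (max_le (by linarith) (by linarith)) (by linarith)
        _ = ENNReal.ofReal δ * ∫⁻ x, ENNReal.ofReal (max c x) ∂(F : Measure ℝ) +
            ENNReal.ofReal δ * ENNReal.ofReal (y - c) := by
            rw [lintegral_add_right _ measurable_const, mul_add]
            simp
        _ ≤ ENNReal.ofReal c + ENNReal.ofReal (y - c) := by
            gcongr
            exact mul_le_of_le_one_left' (by simpa using hδ.2.le)
        _ = ENNReal.ofReal y := by
            rw [← ENNReal.ofReal_add hc (by linarith)]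
            congr 1
            ring
  -- Truncating after finitely many rounds gives the induction a base case, which the recursion for
  -- the full payoff lacks.
  have partials : ∀ n : ℕ, ∀ h : List ℝ, ∑ s ∈ Finset.range n, stagePayoff δ p F s h ≤
      ENNReal.ofReal (max (bestSoFar h) c) := by
    intro n
    induction n with
    | zero => simp
    | succ n ih =>
      intro h
      have hp := p.prob_mem h
      rw [sum_stagePayoff_succ hδ.1.le]
      calc _ ≤ ENNReal.ofReal (p.prob h * max (bestSoFar h) c) +
            ENNReal.ofReal (1 - p.prob h) * ENNReal.ofReal (max (bestSoFar h) c) := by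
            rw [ENNReal.ofReal_mul (sub_nonneg.2 hp.2), mul_assoc]
            gcongr
            · exact hp.1
            · exact le_max_left _ _
            · refine le_trans ?_ (key _)
              gcongr with x
              simpa only [bestSoFar_append_singleton] using ih (h ++ [x])
        _ = ENNReal.ofReal (max (bestSoFar h) c) := by
            have hm : 0 ≤ max (bestSoFar h) c := le_max_of_le_right hc
            rw [← ENNReal.ofReal_mul (by linarith [hp.2]), ← ENNReal.ofReal_add
              (mul_nonneg hp.1 hm) (mul_nonneg (by linarith [hp.2]) hm)]
            congr 1
            ring
  rw [envPayoff_eq_tsum, ENNReal.tsum_eq_iSup_nat]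
  exact iSup_le fun n => partials n h

/-- The reservation value of an environment with finite mean. -/
theorem exists_reservationValue {δ : ℝ} (hδ : δ ∈ Ioo (0 : ℝ) 1) (F : ProbabilityMeasure ℝ)
    (hF : Integrable (fun x : ℝ => x) (F : Measure ℝ)) (hF0 : ∀ᵐ x ∂(F : Measure ℝ), 0 ≤ x) :
    ∃ c : ℝ, 0 ≤ c ∧ δ * ∫ x, max c x ∂(F : Measure ℝ) = c := by
  have hint : ∀ c : ℝ, Integrable (fun x : ℝ => max c x) (F : Measure ℝ) := fun c =>
    (integrable_const c).sup hF
  -- The contraction constant is `δ` because `max · x` is 1-Lipschitz for every `x`.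
  have hcontr : ContractingWith ⟨δ, hδ.1.le⟩
      fun c : ℝ => δ * ∫ x, max c x ∂(F : Measure ℝ) := by
    refine ⟨hδ.2, LipschitzWith.of_dist_le_mul fun a b => ?_⟩
    rw [Real.dist_eq, Real.dist_eq, ← mul_sub, abs_mul, abs_of_pos hδ.1,
      ← integral_sub (hint a) (hint b)]
    refine mul_le_mul_of_nonneg_left ?_ hδ.1.le
    have := norm_integral_le_of_norm_le_const (μ := (F : Measure ℝ))
      (f := fun x => max a x - max b x) (C := |a - b|)
      (Filter.Eventually.of_forall fun x => abs_max_sub_max_le_abs a b x)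
    simpa using this
  refine ⟨hcontr.fixedPoint, ?_, hcontr.fixedPoint_isFixedPt⟩
  rw [← hcontr.fixedPoint_isFixedPt.eq]
  refine mul_nonneg hδ.1.le (integral_nonneg_of_ae ?_)
  filter_upwards [hF0] with x hx using le_max_of_le_right hx

/-! ### Guarantees of the constant rule in a known environment -/

section ConstantRule

variable {δ : ℝ} (hδ : δ ∈ Ioo (0 : ℝ) 1)

/-- The stationary rule that stops with probability `(1 - δ) / (2 - δ)`. -/
abbrev quarterRule : DecisionRule := constantRule ((1 - δ) / (2 - δ)) (quarterProb_mem hδ)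

theorem envPayoff_quarterRule (F : ProbabilityMeasure ℝ) (h : List ℝ) :
    envPayoff δ (quarterRule hδ) F h =
      ENNReal.ofReal ((1 - δ) / (2 - δ) * bestSoFar h) + ENNReal.ofReal (δ / (2 - δ)) *
        ∫⁻ x, envPayoff δ (quarterRule hδ) F (h ++ [x]) ∂(F : Measure ℝ) := by
  have e : (1 - (1 - δ) / (2 - δ)) * δ = δ / (2 - δ) := by
    have : 2 - δ ≠ 0 := by linarith [hδ.2]
    field_simp
    ring
  rw [envPayoff_eq hδ.1.le]
  simp only [quarterRule, constantRule, e]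

/-- The best-so-far alternative never falls, and `y / 2` is the fixed point of `u = (1 - δ) / (2 -
δ) * y + δ / (2 - δ) * u`; unrolling `n` rounds leaves a geometric error. -/
theorem half_le_envPayoff_quarterRule_aux (F : ProbabilityMeasure ℝ) (n : ℕ) (h : List ℝ) :
    ENNReal.ofReal ((1 - (δ / (2 - δ)) ^ n) * (bestSoFar h / 2)) ≤
      envPayoff δ (quarterRule hδ) F h := by
  obtain ⟨h0, h1⟩ := hδ
  have h2 : 0 < 2 - δ := by linarith
  have hr : 0 ≤ δ / (2 - δ) := by positivity
  have hr1 : δ / (2 - δ) ≤ 1 := by rw [div_le_one h2]; linarith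
  induction n generalizing h with
  | zero => simp
  | succ n ih =>
    have hy := bestSoFar_nonneg h
    have hn : (δ / (2 - δ)) ^ n ≤ 1 := pow_le_one₀ hr hr1
    have hstep : ENNReal.ofReal ((1 - (δ / (2 - δ)) ^ n) * (bestSoFar h / 2)) ≤
        ∫⁻ x, envPayoff δ (quarterRule ⟨h0, h1⟩) F (h ++ [x]) ∂(F : Measure ℝ) := by
      calc _ = ∫⁻ _, ENNReal.ofReal ((1 - (δ / (2 - δ)) ^ n) * (bestSoFar h / 2))
            ∂(F : Measure ℝ) := by simp
        _ ≤ _ := by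
          refine lintegral_mono fun x => le_trans (ENNReal.ofReal_le_ofReal ?_) (ih (h ++ [x]))
          refine mul_le_mul_of_nonneg_left ?_ (by linarith)
          rw [bestSoFar_append_singleton]
          linarith [le_max_left (bestSoFar h) x]
    rw [envPayoff_quarterRule ⟨h0, h1⟩]
    refine le_trans (le_of_eq ?_) (add_le_add le_rfl (mul_le_mul_right hstep _))
    rw [← ENNReal.ofReal_mul hr, ← ENNReal.ofReal_add (by
      refine mul_nonneg (div_nonneg (by linarith) h2.le) hy) (by
      refine mul_nonneg hr (mul_nonneg (by linarith) (by linarith)))]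
    congr 1
    rw [pow_succ]
    generalize (δ / (2 - δ)) ^ n = t
    field_simp
    ring

/-- For `y ≥ c` this follows from `hhalf`. For `y < c`, the one-step recursion preserves the bound
up to a geometric error: the equation for `c` evaluates the mean of `max c x`. -/
theorem reservation_le_envPayoff_quarterRule_aux (F : ProbabilityMeasure ℝ)
    (hF : Integrable (fun x : ℝ => x) (F : Measure ℝ)) {c : ℝ} (hc : 0 ≤ c)
    (hcF : δ * ∫ x, max c x ∂(F : Measure ℝ) = c)
    (hhalf : ∀ h, ENNReal.ofReal (bestSoFar h / 2) ≤ envPayoff δ (quarterRule hδ) F h)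
    (n : ℕ) (h : List ℝ) :
    ENNReal.ofReal ((bestSoFar h + max (bestSoFar h) c) / 4 - (δ / (2 - δ)) ^ n * (c / 4)) ≤
      envPayoff δ (quarterRule hδ) F h := by
  obtain ⟨h0, h1⟩ := hδ
  have h2 : 0 < 2 - δ := by linarith
  have hr : 0 ≤ δ / (2 - δ) := by positivity
  have hr1 : δ / (2 - δ) ≤ 1 := by rw [div_le_one h2]; linarith
  induction n generalizing h with
  | zero =>
    refine le_trans (ENNReal.ofReal_le_ofReal ?_) (hhalf h)
    have hy := bestSoFar_nonneg h
    have : max (bestSoFar h) c ≤ bestSoFar h + c := max_le (by linarith) (by linarith)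
    simp only [pow_zero]
    linarith
  | succ n ih =>
    have hy := bestSoFar_nonneg h
    set y := bestSoFar h with hy_def
    set t := (δ / (2 - δ)) ^ n with ht_def
    have ht0 : 0 ≤ t := pow_nonneg hr n
    have ht : t ≤ 1 := pow_le_one₀ hr hr1
    rcases le_total c y with hcy | hcy
    · refine le_trans (ENNReal.ofReal_le_ofReal ?_) (hhalf h)
      rw [← hy_def, max_eq_left hcy]
      have : 0 ≤ (δ / (2 - δ)) ^ (n + 1) * (c / 4) := by positivity
      linarith
    have hmax : Integrable (fun x : ℝ => max c x) (F : Measure ℝ) := (integrable_const c).sup hF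
    have hmean : ∫ x, max c x ∂(F : Measure ℝ) = c / δ := by
      rw [eq_div_iff h0.ne', mul_comm, hcF]
    have hint : Integrable (fun x : ℝ => max c x / 2 + ((y - c) / 4 - t * (c / 4)))
        (F : Measure ℝ) := (hmax.div_const 2).add (integrable_const _)
    have hstep : ENNReal.ofReal (c / δ / 2 + ((y - c) / 4 - t * (c / 4))) ≤
        ∫⁻ x, envPayoff δ (quarterRule ⟨h0, h1⟩) F (h ++ [x]) ∂(F : Measure ℝ) := by
      have hi : ∫ x, (max c x / 2 + ((y - c) / 4 - t * (c / 4))) ∂(F : Measure ℝ) =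
          c / δ / 2 + ((y - c) / 4 - t * (c / 4)) := by
        rw [integral_add (hmax.div_const 2) (integrable_const _), integral_div, hmean]
        simp
      have hn : 0 ≤ᵐ[(F : Measure ℝ)]
          fun x : ℝ => max c x / 2 + ((y - c) / 4 - t * (c / 4)) := by
        refine Filter.Eventually.of_forall fun x => ?_
        have := le_max_left c x
        have : t * (c / 4) ≤ c / 4 := mul_le_of_le_one_left (by positivity) ht
        simp only [Pi.zero_apply]
        linarith
      rw [← hi, ofReal_integral_eq_lintegral_ofReal hint hn]
      refine lintegral_mono fun x => le_trans (ENNReal.ofReal_le_ofReal ?_) (ih (h ++ [x]))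
      rw [bestSoFar_append_singleton, ← hy_def]
      have e1 : max c x ≤ max (max y x) c := max_le (le_max_right _ _)
        (le_max_of_le_left (le_max_right _ _))
      -- Lowering the fallback from `c` to `y` costs at most `c - y`.
      have e2 : max c x + (y - c) ≤ max y x := by
        rcases le_total c x with hx | hx
        · rw [max_eq_right hx]; linarith [le_max_right y x]
        · rw [max_eq_left hx]; linarith [le_max_left y x]
      linarith
    have hcδ : c ≤ c / δ := by rw [le_div_iff₀ h0]; exact mul_le_of_le_one_right hc h1.le
    have htc : t * (c / 4) ≤ c / 4 := mul_le_of_le_one_left (by positivity) ht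
    rw [envPayoff_quarterRule ⟨h0, h1⟩]
    refine le_trans ?_ (add_le_add le_rfl (mul_le_mul_right hstep _))
    rw [← ENNReal.ofReal_mul hr, ← ENNReal.ofReal_add (by
      refine mul_nonneg (div_nonneg (by linarith) h2.le) hy) (by
      refine mul_nonneg hr (by linarith))]
    apply ENNReal.ofReal_le_ofReal
    rw [max_eq_right hcy, pow_succ, ← ht_def, ← hy_def]
    -- With this stopping probability the coefficient of `c` is exactly `1/4`, so the slack is a
    -- nonnegative multiple of `y` alone.
    have : (1 - δ) / (2 - δ) * y + δ / (2 - δ) * (c / δ / 2 + ((y - c) / 4 - t * (c / 4))) -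
        ((y + c) / 4 - t * (δ / (2 - δ)) * (c / 4)) = (1 - δ) * y / (2 * (2 - δ)) := by
      field_simp
      ring
    have : 0 ≤ (1 - δ) * y / (2 * (2 - δ)) :=
      div_nonneg (mul_nonneg (by linarith) hy) (by linarith)
    linarith

theorem ofReal_le_of_forall_sub_pow {r a b : ℝ} (hr : 0 ≤ r) (hr1 : r < 1) {u : ℝ≥0∞}
    (hu : ∀ n : ℕ, ENNReal.ofReal (a - r ^ n * b) ≤ u) : ENNReal.ofReal a ≤ u := by
  have h1 : Filter.Tendsto (fun n : ℕ => a - r ^ n * b) Filter.atTop (nhds (a - 0 * b)) :=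
    ((tendsto_pow_atTop_nhds_zero_of_lt_one hr hr1).mul_const b).const_sub a
  have h2 := (ENNReal.continuous_ofReal.tendsto _).comp h1
  rw [zero_mul, sub_zero] at h2
  exact le_of_tendsto' h2 hu

theorem half_le_envPayoff_quarterRule (F : ProbabilityMeasure ℝ) (h : List ℝ) :
    ENNReal.ofReal (bestSoFar h / 2) ≤ envPayoff δ (quarterRule hδ) F h := by
  have h2 : 0 < 2 - δ := by linarith [hδ.2]
  refine ofReal_le_of_forall_sub_pow (b := bestSoFar h / 2) (div_nonneg hδ.1.le h2.le)
    (by rw [div_lt_one h2]; linarith [hδ.2]) fun n => ?_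
  refine le_trans (le_of_eq ?_) (half_le_envPayoff_quarterRule_aux hδ F n h)
  congr 1
  ring

theorem reservation_le_envPayoff_quarterRule (F : ProbabilityMeasure ℝ)
    (hF : Integrable (fun x : ℝ => x) (F : Measure ℝ)) {c : ℝ} (hc : 0 ≤ c)
    (hcF : δ * ∫ x, max c x ∂(F : Measure ℝ) = c) (h : List ℝ) :
    ENNReal.ofReal ((bestSoFar h + max (bestSoFar h) c) / 4) ≤
      envPayoff δ (quarterRule hδ) F h := by
  have h2 : 0 < 2 - δ := by linarith [hδ.2]
  exact ofReal_le_of_forall_sub_pow (b := c / 4) (div_nonneg hδ.1.le h2.le)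
    (by rw [div_lt_one h2]; linarith [hδ.2]) fun n =>
      reservation_le_envPayoff_quarterRule_aux hδ F hF hc hcF
        (half_le_envPayoff_quarterRule hδ F) n h

end ConstantRule

/-- In a known environment, the payoff of every rule is finite and at most four times the payoff
of `quarterRule`. -/
theorem envPayoff_ne_top_and_le {δ : ℝ} (hδ : δ ∈ Ioo (0 : ℝ) 1) {X : Set ℝ} (hX : X ⊆ Ici 0)
    {F : ProbabilityMeasure ℝ} (hF : F ∈ environments X) (p : DecisionRule) (h : List ℝ) :
    envPayoff δ p F h ≠ ⊤ ∧ envPayoff δ p F h ≤ 4 * envPayoff δ (quarterRule hδ) F h := by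
  have hF0 : ∀ᵐ x ∂(F : Measure ℝ), 0 ≤ x := by
    have : ∀ᵐ x ∂(F : Measure ℝ), x ∈ X := hF.1
    filter_upwards [this] with x hx using hX hx
  obtain ⟨c, hc, hcF⟩ := exists_reservationValue hδ F hF.2 hF0
  have hle := envPayoff_le hδ p F hc (by
    have hint : Integrable (fun x : ℝ => max c x) (F : Measure ℝ) :=
      (integrable_const c).sup hF.2
    rw [← ofReal_integral_eq_lintegral_ofReal hint
      (Filter.Eventually.of_forall fun x => le_max_of_le_left hc), ← ENNReal.ofReal_mul hδ.1.le]
    exact le_of_eq (congrArg _ hcF)) h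
  refine ⟨ne_top_of_le_ne_top ENNReal.ofReal_ne_top hle, hle.trans ?_⟩
  calc ENNReal.ofReal (max (bestSoFar h) c)
      ≤ ENNReal.ofReal (4 * ((bestSoFar h + max (bestSoFar h) c) / 4)) := by
        apply ENNReal.ofReal_le_ofReal
        linarith [bestSoFar_nonneg h]
    _ = 4 * ENNReal.ofReal ((bestSoFar h + max (bestSoFar h) c) / 4) := by
        rw [ENNReal.ofReal_mul (by norm_num)]
        norm_num
    _ ≤ _ := by
        gcongr
        exact reservation_le_envPayoff_quarterRule hδ F hF.2 hc hcF h

/-! ### From known environments to priors -/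

theorem likelihood_le_one (F : ProbabilityMeasure ℝ) (h : List ℝ) : likelihood F h ≤ 1 := by
  unfold likelihood
  induction h.tail with
  | nil => simp
  | cons a l ih => simpa using mul_le_one' prob_le_one ih

theorem evidence_ne_top (μ : PMF (ProbabilityMeasure ℝ)) (h : List ℝ) : evidence μ h ≠ ⊤ := by
  refine ne_top_of_le_ne_top ENNReal.one_ne_top ?_
  rw [← μ.tsum_coe]
  exact ENNReal.tsum_le_tsum fun F => mul_le_of_le_one_right' (likelihood_le_one F h)

theorem posterior_ne_top (μ : PMF (ProbabilityMeasure ℝ)) {h : List ℝ} (hμ : 0 < evidence μ h)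
    (F : ProbabilityMeasure ℝ) : posterior μ h F ≠ ⊤ :=
  ENNReal.div_ne_top (ENNReal.mul_ne_top (μ.apply_ne_top F)
    (ne_top_of_le_ne_top ENNReal.one_ne_top (likelihood_le_one F h))) hμ.ne'

theorem quarter_le_performanceRatio {δ : ℝ} (hδ : δ ∈ Ioo (0 : ℝ) 1) {x₀ : ℝ} (hx₀ : 0 < x₀)
    {X : Set ℝ} (hX : X ⊆ Ici 0) :
    1 / 4 ≤ performanceRatio δ (quarterRule hδ) x₀ (environments X) := by
  refine le_iInf₂ fun h hh => le_iInf₂ fun μ hμ => ?_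
  obtain ⟨d, rfl⟩ := hh
  obtain ⟨⟨hfin, hsub⟩, hev⟩ := hμ
  set h := x₀ :: d
  have hzero : ∀ F ∉ μ.support, posterior μ h F = 0 := fun F hF => by
    rw [PMF.mem_support_iff, not_not] at hF
    simp [posterior, hF]
  -- Finiteness (from the finite support) and positivity (from `0 < x₀`) allow the ratio in `ℝ≥0∞`
  -- to be cleared of its denominator.
  have htop : payoff δ (quarterRule hδ) μ h ≠ ⊤ := by
    rw [payoff, tsum_eq_sum (s := hfin.toFinset) fun F hF => by
      rw [hzero F (by simpa using hF), zero_mul]]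
    refine ENNReal.sum_ne_top.2 fun F hF => ENNReal.mul_ne_top (posterior_ne_top μ hev F) ?_
    exact (envPayoff_ne_top_and_le hδ hX (hsub (by simpa using hF)) _ h).1
  have hne : payoff δ (quarterRule hδ) μ h ≠ 0 := by
    obtain ⟨F, hF⟩ : ∃ F, μ F * likelihood F h ≠ 0 := by
      by_contra! hcon
      exact hev.ne' (by simp [evidence, hcon])
    have hpos : 0 < bestSoFar h / 2 :=
      half_pos (hx₀.trans_le (le_bestSoFar List.mem_cons_self))
    intro h0
    rw [payoff, ENNReal.tsum_eq_zero] at h0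
    rcases mul_eq_zero.1 (h0 F) with h0 | h0
    · exact (ENNReal.div_ne_zero.2 ⟨hF, evidence_ne_top μ h⟩) h0
    · have := half_le_envPayoff_quarterRule hδ F h
      rw [h0] at this
      exact absurd (ENNReal.ofReal_eq_zero.1 (le_antisymm this zero_le)) (not_le.2 hpos)
  have hle : optimalPayoff δ μ h ≤ 4 * payoff δ (quarterRule hδ) μ h := by
    refine iSup_le fun p => ?_
    rw [payoff, payoff, ← ENNReal.tsum_mul_left]
    refine ENNReal.tsum_le_tsum fun F => ?_
    by_cases hF : F ∈ μ.support
    · rw [mul_left_comm]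
      gcongr
      exact (envPayoff_ne_top_and_le hδ hX (hsub hF) p h).2
    · simp [hzero F hF]
  rw [ENNReal.le_div_iff_mul_le (Or.inr hne) (Or.inr htop), one_div, mul_comm,
    ← div_eq_mul_inv]
  exact ENNReal.div_le_of_le_mul' hle

/-! ### Behaviour of a rule while only zeros arrive -/

/-- The environment in which every alternative is `0`. -/
def zeroEnv : ProbabilityMeasure ℝ := ⟨Measure.dirac 0, inferInstance⟩

/-- The payoff of the rule `p` after `h` when all further alternatives are `0`, as a fraction of
the best-so-far alternative. -/
def zeroRatio (δ : ℝ) (p : DecisionRule) (h : List ℝ) : ℝ :=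
  (envPayoff δ p zeroEnv h).toReal / bestSoFar h

theorem zeroRatio_nonneg (δ : ℝ) (p : DecisionRule) (h : List ℝ) : 0 ≤ zeroRatio δ p h :=
  div_nonneg ENNReal.toReal_nonneg (bestSoFar_nonneg h)

theorem envPayoff_zeroEnv_le {δ : ℝ} (hδ : δ ∈ Ioo (0 : ℝ) 1) (p : DecisionRule) (h : List ℝ) :
    envPayoff δ p zeroEnv h ≤ ENNReal.ofReal (bestSoFar h) := by
  have := envPayoff_le hδ p zeroEnv le_rfl (by simp [zeroEnv]) h
  rwa [max_eq_left (bestSoFar_nonneg h)] at this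

theorem zeroRatio_le_one {δ : ℝ} (hδ : δ ∈ Ioo (0 : ℝ) 1) (p : DecisionRule) (h : List ℝ) :
    zeroRatio δ p h ≤ 1 :=
  div_le_one_of_le₀ (ENNReal.toReal_le_of_le_ofReal (bestSoFar_nonneg h)
    (envPayoff_zeroEnv_le hδ p h)) (bestSoFar_nonneg h)

theorem bestSoFar_append_zero (h : List ℝ) : bestSoFar (h ++ [0]) = bestSoFar h := by
  rw [bestSoFar_append_singleton, max_eq_left (bestSoFar_nonneg h)]

theorem zeroRatio_eq {δ : ℝ} (hδ : δ ∈ Ioo (0 : ℝ) 1) (p : DecisionRule) {h : List ℝ}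
    (hh : 0 < bestSoFar h) :
    zeroRatio δ p h = p.prob h + (1 - p.prob h) * δ * zeroRatio δ p (h ++ [0]) := by
  have hp := p.prob_mem h
  have hq : 0 ≤ (1 - p.prob h) * δ := mul_nonneg (sub_nonneg.2 hp.2) hδ.1.le
  have hfin := ne_top_of_le_ne_top ENNReal.ofReal_ne_top (envPayoff_zeroEnv_le hδ p (h ++ [0]))
  have hd : ∫⁻ x, envPayoff δ p zeroEnv (h ++ [x]) ∂(zeroEnv : Measure ℝ) =
      envPayoff δ p zeroEnv (h ++ [0]) := by
    simp only [zeroEnv, ProbabilityMeasure.coe_mk, lintegral_dirac]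
  rw [zeroRatio, zeroRatio, envPayoff_eq hδ.1.le, hd, ENNReal.toReal_add ENNReal.ofReal_ne_top
    (ENNReal.mul_ne_top ENNReal.ofReal_ne_top hfin), ENNReal.toReal_mul,
    ENNReal.toReal_ofReal (mul_nonneg hp.1 hh.le), ENNReal.toReal_ofReal hq,
    bestSoFar_append_zero]
  field_simp

/-- If stopping is worth `y`, and each round brings at most `R` in addition to the value of drawing
a `0`, then the value at `h` is controlled by `zeroRatio`. -/
theorem le_of_zero_recursion {δ : ℝ} (hδ : δ ∈ Ioo (0 : ℝ) 1) (p : DecisionRule)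
    {P : List ℝ → Prop} {y Z R : ℝ} (hy : 0 < y) (hR : 0 ≤ R)
    (hP : ∀ h, P h → bestSoFar h = y ∧ P (h ++ [0])) {u : List ℝ → ℝ}
    (hu : ∀ h, P h → u h ≤ Z)
    (hrec : ∀ h, P h → u h ≤ p.prob h * y + (1 - p.prob h) * δ * (u (h ++ [0]) + R))
    {h : List ℝ} (hh : P h) :
    u h ≤ y * zeroRatio δ p h + R * (δ * (1 - zeroRatio δ p h) / (1 - δ)) := by
  have h1 : 0 < 1 - δ := sub_pos.2 hδ.2
  -- The crude bound `Z` serves only to start the induction; its contribution is discounted away as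
  -- `n` grows.
  have key : ∀ n : ℕ, ∀ h, P h → u h ≤
      y * zeroRatio δ p h + R * (δ * (1 - zeroRatio δ p h) / (1 - δ)) + δ ^ n * |Z| := by
    intro n
    induction n with
    | zero =>
      intro h hh
      have e1 := mul_nonneg hy.le (zeroRatio_nonneg δ p h)
      have e2 : 0 ≤ R * (δ * (1 - zeroRatio δ p h) / (1 - δ)) :=
        mul_nonneg hR (div_nonneg (mul_nonneg hδ.1.le
          (sub_nonneg.2 (zeroRatio_le_one hδ p h))) h1.le)
      rw [pow_zero, one_mul]
      linarith [hu h hh, le_abs_self Z]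
    | succ n ih =>
      intro h hh
      obtain ⟨hb, h0⟩ := hP h hh
      have hp := p.prob_mem h
      have hp1 : 0 ≤ 1 - p.prob h := sub_nonneg.2 hp.2
      have e1 := ih _ h0
      have e2 := hrec h hh
      have e3 : (1 - p.prob h) * δ * (u (h ++ [0]) + R) ≤ (1 - p.prob h) * δ *
          (y * zeroRatio δ p (h ++ [0]) +
            R * (δ * (1 - zeroRatio δ p (h ++ [0])) / (1 - δ)) + R) +
          δ ^ (n + 1) * |Z| := by
        have e4 : (1 - p.prob h) * (δ ^ (n + 1) * |Z|) ≤ δ ^ (n + 1) * |Z| :=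
          mul_le_of_le_one_left (mul_nonneg (pow_nonneg hδ.1.le _) (abs_nonneg Z))
            (by linarith [hp.1])
        have e5 := mul_le_mul_of_nonneg_left (add_le_add_left e1 R) (mul_nonneg hp1 hδ.1.le)
        rw [pow_succ] at e4 ⊢
        linarith
      rw [zeroRatio_eq hδ p (hb ▸ hy)]
      refine e2.trans ((add_le_add_right e3 _).trans (le_of_eq ?_))
      field_simp
      ring
  have hlim : Filter.Tendsto (fun n : ℕ => y * zeroRatio δ p h +
      R * (δ * (1 - zeroRatio δ p h) / (1 - δ)) + δ ^ n * |Z|) Filter.atTop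
      (nhds (y * zeroRatio δ p h + R * (δ * (1 - zeroRatio δ p h) / (1 - δ)) + 0 * |Z|)) :=
    ((tendsto_pow_atTop_nhds_zero_of_lt_one hδ.1.le hδ.2).mul_const _).const_add _
  rw [zero_mul, add_zero] at hlim
  exact ge_of_tendsto' hlim fun n => key n h hh

/-! ### Environments with a rare high alternative -/

/-- The environment `G` yields `z` with probability `q`, is drawn from `ν` with probability `η`,
and yields `0` otherwise. -/
structure IsSearchEnv (G : ProbabilityMeasure ℝ) (ν : Measure ℝ) (q η z : ℝ) : Prop where
  prob : IsProbabilityMeasure ν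
  ae_le : ∀ᵐ x ∂ν, x ≤ z
  q_nonneg : 0 ≤ q
  η_nonneg : 0 ≤ η
  add_le_one : q + η ≤ 1
  z_nonneg : 0 ≤ z
  eq_add : (G : Measure ℝ) = ENNReal.ofReal (1 - q - η) • Measure.dirac 0 +
    ENNReal.ofReal q • Measure.dirac z + ENNReal.ofReal η • ν

theorem exists_isSearchEnv {X : Set ℝ} (hXm : MeasurableSet X) (hX : X ⊆ Ici 0)
    (h0 : (0 : ℝ) ∈ X) {d : List ℝ} (hd : ∀ x ∈ d, x ∈ X) {q η z : ℝ} (hz : z ∈ X)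
    (hdz : ∀ x ∈ d, x ≤ z) (hq : 0 ≤ q) (hη : 0 < η) (hqη : q + η ≤ 1) :
    ∃ G ∈ environments X, (∃ ν, IsSearchEnv G ν q η z) ∧ ∀ x ∈ d, (G : Measure ℝ) {x} ≠ 0 := by
  -- This component gives every past draw positive mass, so that the history is possible; inserting
  -- `0` keeps the finite set nonempty when `d` is empty.
  set P := PMF.uniformOfFinset (insert 0 d.toFinset) (Finset.insert_nonempty _ _) with hP
  set Y := X ∩ Iic z with hY
  have hYm : MeasurableSet Y := hXm.inter measurableSet_Iic
  have hz0 : 0 ≤ z := hX hz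
  have h0Y : (0 : ℝ) ∈ Y := ⟨h0, hz0⟩
  have hνY : P.toMeasure Yᶜ = 0 := by
    rw [PMF.toMeasure_apply_eq_zero_iff _ hYm.compl, Set.disjoint_compl_right_iff_subset]
    intro x hx
    simp only [hP, PMF.support_uniformOfFinset, Finset.coe_insert, List.coe_toFinset,
      Set.mem_insert_iff, Set.mem_ofPred_eq] at hx
    rcases hx with rfl | hx
    · exact h0Y
    · exact ⟨hd x hx, hdz x hx⟩
  have hνd : ∀ x ∈ d, P.toMeasure {x} ≠ 0 := by
    intro x hx
    rw [PMF.toMeasure_apply_singleton _ _ (measurableSet_singleton x), ← PMF.mem_support_iff]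
    simp [hP, hx]
  set M : Measure ℝ := ENNReal.ofReal (1 - q - η) • Measure.dirac 0 +
    ENNReal.ofReal q • Measure.dirac z + ENNReal.ofReal η • P.toMeasure with hM
  have hMp : IsProbabilityMeasure M := by
    refine ⟨?_⟩
    simp only [hM, Measure.add_apply, Measure.smul_apply, measure_univ, smul_eq_mul, mul_one]
    rw [← ENNReal.ofReal_add (by linarith) hq, ← ENNReal.ofReal_add (by linarith) hη.le]
    ring_nf
    simp
  have hMY : M Yᶜ = 0 := by
    have hzY : z ∈ Y := ⟨hz, self_mem_Iic⟩
    simp [hM, hνY, Measure.dirac_apply' _ hYm.compl, h0Y, hzY]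
  refine ⟨⟨M, hMp⟩, ⟨measure_mono_null (compl_subset_compl.2 inter_subset_left) hMY, ?_⟩,
    ⟨P.toMeasure, inferInstance, ?_, hq, hη.le, hqη, hz0, rfl⟩, fun x hx => ?_⟩
  · have hae : ∀ᵐ x ∂M, x ∈ Y := hMY
    refine Integrable.of_bound (μ := M) measurable_id.aestronglyMeasurable z ?_
    filter_upwards [hae] with x hx
    rw [Real.norm_of_nonneg (hX hx.1)]
    exact hx.2
  · have hae : ∀ᵐ x ∂P.toMeasure, x ∈ Y := hνY
    filter_upwards [hae] with x hx using hx.2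
  · have hne : ENNReal.ofReal η * P.toMeasure {x} ≠ 0 :=
      mul_ne_zero (by simpa using hη) (hνd x hx)
    simp only [ProbabilityMeasure.coe_mk, hM, Measure.add_apply, Measure.smul_apply, smul_eq_mul]
    exact (pos_of_ne_zero hne |>.trans_le le_add_self).ne'

namespace IsSearchEnv

variable {G : ProbabilityMeasure ℝ} {ν : Measure ℝ} {q η z : ℝ}

theorem lintegral_eq (hG : IsSearchEnv G ν q η z) (f : ℝ → ℝ≥0∞) :
    ∫⁻ x, f x ∂(G : Measure ℝ) = ENNReal.ofReal (1 - q - η) * f 0 + ENNReal.ofReal q * f z +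
      ENNReal.ofReal η * ∫⁻ x, f x ∂ν := by
  rw [hG.eq_add, lintegral_add_measure, lintegral_add_measure, lintegral_smul_measure,
    lintegral_smul_measure, lintegral_smul_measure, lintegral_dirac, lintegral_dirac]
  simp only [smul_eq_mul]

theorem lintegral_le (hG : IsSearchEnv G ν q η z) {f : ℝ → ℝ≥0∞} {b : ℝ≥0∞}
    (hf : ∀ x ≤ z, f x ≤ b) :
    ∫⁻ x, f x ∂ν ≤ b := by
  have := hG.prob
  calc ∫⁻ x, f x ∂ν ≤ ∫⁻ _, b ∂ν :=
        lintegral_mono_ae (by filter_upwards [hG.ae_le] with x hx using hf x hx)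
    _ = b := by simp

theorem envPayoff_le_max {δ : ℝ} (hδ : δ ∈ Ioo (0 : ℝ) 1)
    (hG : IsSearchEnv G ν q η z) (p : DecisionRule) {h : List ℝ}
    (hh : bestSoFar h ≤ z) : envPayoff δ p G h ≤ ENNReal.ofReal z := by
  have hmax : ∀ x ≤ z, ENNReal.ofReal (max z x) ≤ ENNReal.ofReal z := fun x hx => by
    rw [max_eq_left hx]
  have := envPayoff_le hδ p G hG.z_nonneg (by
    rw [hG.lintegral_eq]
    have hq := hG.q_nonneg
    have hη := hG.η_nonneg
    have hs := hG.add_le_one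
    calc _ ≤ 1 * (ENNReal.ofReal (1 - q - η) * ENNReal.ofReal z +
          ENNReal.ofReal q * ENNReal.ofReal z + ENNReal.ofReal η * ENNReal.ofReal z) := by
          gcongr
          · simpa using hδ.2.le
          · rw [max_eq_left hG.z_nonneg]
          · rw [max_self]
          · exact hG.lintegral_le hmax
      _ = ENNReal.ofReal z := by
          rw [one_mul, ← add_mul, ← add_mul, ← ENNReal.ofReal_add (by linarith) hq,
            ← ENNReal.ofReal_add (by linarith) hη]
          ring_nf
          simp) h
  rwa [max_eq_right hh] at this

theorem envPayoff_ne_top {δ : ℝ} (hδ : δ ∈ Ioo (0 : ℝ) 1)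
    (hG : IsSearchEnv G ν q η z) (p : DecisionRule) {h : List ℝ}
    (hh : bestSoFar h ≤ z) : envPayoff δ p G h ≠ ⊤ :=
  ne_top_of_le_ne_top ENNReal.ofReal_ne_top (hG.envPayoff_le_max hδ p hh)

theorem toReal_envPayoff_le {δ : ℝ} (hδ : δ ∈ Ioo (0 : ℝ) 1)
    (hG : IsSearchEnv G ν q η z) (p : DecisionRule) {h : List ℝ}
    (hh : bestSoFar h ≤ z) : (envPayoff δ p G h).toReal ≤ z :=
  ENNReal.toReal_le_of_le_ofReal hG.z_nonneg (hG.envPayoff_le_max hδ p hh)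

/-- Two roundings suit `le_of_zero_recursion`: the weight `1 - q - η` of a zero is raised to `1`,
and after a draw from `ν` the continuation is credited its maximum `z`. -/
theorem toReal_envPayoff_recursion {δ : ℝ} (hδ : δ ∈ Ioo (0 : ℝ) 1)
    (hG : IsSearchEnv G ν q η z) (p : DecisionRule) {h : List ℝ}
    (hh : bestSoFar h ≤ z) :
    (envPayoff δ p G h).toReal ≤ p.prob h * bestSoFar h + (1 - p.prob h) * δ *
      ((envPayoff δ p G (h ++ [0])).toReal +
        (q * (envPayoff δ p G (h ++ [z])).toReal + η * z)) := by
  have hp := p.prob_mem h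
  have hq := hG.q_nonneg
  have hη := hG.η_nonneg
  have hz := hG.z_nonneg
  have hp1 : 0 ≤ (1 - p.prob h) * δ := mul_nonneg (sub_nonneg.2 hp.2) hδ.1.le
  have happ : ∀ x ≤ z, bestSoFar (h ++ [x]) ≤ z := fun x hx => by
    rw [bestSoFar_append_singleton]
    exact max_le hh hx
  refine ENNReal.toReal_le_of_le_ofReal ?_ ?_
  · have := bestSoFar_nonneg h
    have := hp.1
    positivity
  rw [envPayoff_eq hδ.1.le, hG.lintegral_eq, ENNReal.ofReal_add
    (mul_nonneg hp.1 (bestSoFar_nonneg h)) (by positivity), ENNReal.ofReal_mul hp1,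
    ENNReal.ofReal_add (by positivity) (by positivity),
    ENNReal.ofReal_add (by positivity) (by positivity),
    ENNReal.ofReal_mul hq, ENNReal.ofReal_mul hη,
    ENNReal.ofReal_toReal (hG.envPayoff_ne_top hδ p (happ 0 hz)),
    ENNReal.ofReal_toReal (hG.envPayoff_ne_top hδ p (happ z le_rfl)), add_assoc]
  gcongr
  · refine mul_le_of_le_one_left' ?_
    rw [ENNReal.ofReal_le_one]
    linarith
  · exact hG.lintegral_le fun x hx => hG.envPayoff_le_max hδ p (happ x hx)

end IsSearchEnv

/-- The rule that stops as soon as an alternative of at least `z` is available. -/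
def thresholdRule (z : ℝ) : DecisionRule where
  prob h := if z ≤ bestSoFar h then 1 else 0
  prob_mem h := by split_ifs <;> simp
  measurable_prob n := by
    have hm : Measurable fun v : Fin n → ℝ => bestSoFar (List.ofFn v) := by
      have := measurable_bestSoFar_map (List.ofFn fun (i : Fin n) (v : Fin n → ℝ) => v i)
        (by simp only [List.mem_ofFn]; rintro f ⟨i, rfl⟩; exact measurable_pi_apply i)
      simpa [List.map_ofFn, Function.comp_def] using this
    exact Measurable.ite (measurableSet_le measurable_const hm) measurable_const measurable_const

namespace IsSearchEnv

variable {G : ProbabilityMeasure ℝ} {ν : Measure ℝ} {q η z : ℝ}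

theorem le_envPayoff_thresholdRule {δ : ℝ} (hδ : δ ∈ Ioo (0 : ℝ) 1)
    (hG : IsSearchEnv G ν q η z) (h : List ℝ) :
    ENNReal.ofReal (δ * q * z / (1 - δ + δ * q)) ≤ envPayoff δ (thresholdRule z) G h := by
  obtain ⟨h0, h1⟩ := hδ
  have hq := hG.q_nonneg
  have hη := hG.η_nonneg
  have hz := hG.z_nonneg
  have hs := hG.add_le_one
  have hδq : 0 ≤ δ * q := mul_nonneg h0.le hq
  have hden : 0 < 1 - δ + δ * q := by linarith
  -- The value of waiting for `z` when every other draw counts as a failure, i.e. the solution of `c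
  -- = δ (q z + (1 - q) c)`.
  set c := δ * q * z / (1 - δ + δ * q) with hc
  have hc0 : 0 ≤ c := by positivity
  have hcz : c ≤ z := by
    rw [hc, div_le_iff₀ hden]
    nlinarith
  have hceq : δ * (q * z + (1 - q) * c) = c := by
    rw [hc]
    field_simp
    ring
  have hreached : ∀ h, z ≤ bestSoFar h → ENNReal.ofReal z ≤ envPayoff δ (thresholdRule z) G h := by
    intro h hh
    rw [envPayoff_eq h0.le]
    refine le_trans (ENNReal.ofReal_le_ofReal ?_) le_self_add
    simp [thresholdRule, hh]
  refine ofReal_le_of_forall_sub_pow (b := c) h0.le h1 fun n => ?_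
  induction n generalizing h with
  | zero => simp
  | succ n ih =>
    have ht0 : 0 ≤ δ ^ n := pow_nonneg h0.le n
    have ht1 : δ ^ n * c ≤ c := mul_le_of_le_one_left hc0 (pow_le_one₀ h0.le h1.le)
    rcases le_or_gt z (bestSoFar h) with hh | hh
    · refine le_trans (ENNReal.ofReal_le_ofReal ?_) (hreached h hh)
      have : 0 ≤ δ ^ (n + 1) * c := by positivity
      linarith
    have hprob : (thresholdRule z).prob h = 0 := if_neg (not_le.2 hh)
    have := hG.prob
    have hν : ENNReal.ofReal (c - δ ^ n * c) ≤
        ∫⁻ x, envPayoff δ (thresholdRule z) G (h ++ [x]) ∂ν :=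
      calc _ = ∫⁻ _, ENNReal.ofReal (c - δ ^ n * c) ∂ν := by simp
        _ ≤ _ := lintegral_mono fun x => ih (h ++ [x])
    have hz' := hreached (h ++ [z]) (le_bestSoFar (by simp))
    rw [envPayoff_eq h0.le, hprob, hG.lintegral_eq, zero_mul, ENNReal.ofReal_zero, zero_add,
      sub_zero, one_mul]
    calc ENNReal.ofReal (c - δ ^ (n + 1) * c)
        ≤ ENNReal.ofReal (δ * ((1 - q - η) * (c - δ ^ n * c) + q * z +
            η * (c - δ ^ n * c))) := by
          apply ENNReal.ofReal_le_ofReal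
          have : 0 ≤ δ * q * (δ ^ n * c) := by positivity
          rw [pow_succ]
          linarith
      _ = ENNReal.ofReal δ * (ENNReal.ofReal (1 - q - η) * ENNReal.ofReal (c - δ ^ n * c) +
            ENNReal.ofReal q * ENNReal.ofReal z +
            ENNReal.ofReal η * ENNReal.ofReal (c - δ ^ n * c)) := by
          have e1 : 0 ≤ (1 - q - η) * (c - δ ^ n * c) :=
            mul_nonneg (by linarith) (by linarith)
          have e2 : 0 ≤ η * (c - δ ^ n * c) := mul_nonneg hη (by linarith)
          rw [ENNReal.ofReal_mul h0.le, ENNReal.ofReal_add (by positivity) e2,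
            ENNReal.ofReal_add e1 (by positivity), ENNReal.ofReal_mul (by linarith),
            ENNReal.ofReal_mul hq, ENNReal.ofReal_mul hη]
      _ ≤ _ := by
          gcongr
          exact ih _

/-- An upper bound on the payoff of an arbitrary rule when a high alternative `z` is rare. -/
theorem toReal_envPayoff_le_of_zeroRatio_le {δ : ℝ} (hδ : δ ∈ Ioo (0 : ℝ) 1)
    (hG : IsSearchEnv G ν q η z) (p : DecisionRule) {H : Set (List ℝ)}
    (hH0 : ∀ h ∈ H, h ++ [0] ∈ H) (hHz : ∀ h ∈ H, h ++ [z] ∈ H) (hH : ∀ h ∈ H, 0 < bestSoFar h)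
    {a : ℝ} (ha : ∀ h ∈ H, zeroRatio δ p h ≤ a) {h : List ℝ} (hh : h ∈ H)
    (hhz : bestSoFar h ≤ z) :
    (envPayoff δ p G h).toReal ≤ bestSoFar h +
      (q * (z * (a + (q + η) * (δ / (1 - δ)))) + η * z) *
        (δ * (1 - zeroRatio δ p h) / (1 - δ)) := by
  have h1 : 0 < 1 - δ := sub_pos.2 hδ.2
  have hq := hG.q_nonneg
  have hη := hG.η_nonneg
  have hz : 0 < z := (hH h hh).trans_le hhz
  have ha0 : 0 ≤ a := (zeroRatio_nonneg δ p h).trans (ha h hh)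
  have hδ1 : 0 ≤ δ / (1 - δ) := div_nonneg hδ.1.le h1.le
  -- Once `z` is in hand, each further round adds at most `(q + η) z` to the value of a zero draw,
  -- which vanishes relative to `z`.
  have hafter : ∀ h ∈ H, bestSoFar h = z →
      (envPayoff δ p G h).toReal ≤ z * (a + (q + η) * (δ / (1 - δ))) := by
    intro h hh hb
    have hR : 0 ≤ (q + η) * z := by positivity
    have := le_of_zero_recursion hδ p (P := fun h => bestSoFar h = z) (Z := z)
      (R := (q + η) * z) (u := fun h => (envPayoff δ p G h).toReal) hz hR
      (fun h hb => ⟨hb, by rw [bestSoFar_append_zero, hb]⟩)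
      (fun h hb => hG.toReal_envPayoff_le hδ p hb.le)
      (fun h hb => by
        refine (hG.toReal_envPayoff_recursion hδ p hb.le).trans ?_
        rw [hb]
        have := hG.toReal_envPayoff_le hδ p (h := h ++ [z]) (by
          rw [bestSoFar_append_singleton, hb, max_self])
        have hp1 : 0 ≤ (1 - p.prob h) * δ :=
          mul_nonneg (sub_nonneg.2 (p.prob_mem h).2) hδ.1.le
        rw [add_mul]
        gcongr) hb
    refine this.trans ?_
    have e1 : z * zeroRatio δ p h ≤ z * a := mul_le_mul_of_nonneg_left (ha h hh) hz.le
    have e2 : δ * (1 - zeroRatio δ p h) / (1 - δ) ≤ δ / (1 - δ) :=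
      div_le_div_of_nonneg_right (mul_le_of_le_one_right hδ.1.le
        (by linarith [zeroRatio_nonneg δ p h])) h1.le
    have e3 := mul_le_mul_of_nonneg_left e2 hR
    linarith
  have hmain := le_of_zero_recursion hδ p (P := fun h' => h' ∈ H ∧ bestSoFar h' = bestSoFar h)
    (Z := z) (R := q * (z * (a + (q + η) * (δ / (1 - δ)))) + η * z)
    (u := fun h => (envPayoff δ p G h).toReal) (hH h hh) (by positivity)
    (fun h' hb => ⟨hb.2, hH0 _ hb.1, by rw [bestSoFar_append_zero, hb.2]⟩)
    (fun h' hb => hG.toReal_envPayoff_le hδ p (hb.2.le.trans hhz))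
    (fun h' hb => by
      refine (hG.toReal_envPayoff_recursion hδ p (hb.2.le.trans hhz)).trans ?_
      rw [hb.2]
      have := hafter _ (hHz _ hb.1) (by
        rw [bestSoFar_append_singleton, hb.2, max_eq_right hhz])
      have hp1 : 0 ≤ (1 - p.prob h') * δ :=
        mul_nonneg (sub_nonneg.2 (p.prob_mem h').2) hδ.1.le
      gcongr) ⟨hh, rfl⟩
  refine hmain.trans (add_le_add_left ?_ _)
  exact mul_le_of_le_one_right (bestSoFar_nonneg h) (zeroRatio_le_one hδ p h)

end IsSearchEnv

/-! ### No rule guarantees more than one quarter -/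

theorem payoff_pure (δ : ℝ) (p : DecisionRule) {G : ProbabilityMeasure ℝ} {h : List ℝ}
    (hG : likelihood G h ≠ 0) : payoff δ p (PMF.pure G) h = envPayoff δ p G h := by
  have hev : evidence (PMF.pure G) h = likelihood G h := by
    rw [evidence, tsum_eq_single G fun F hF => by simp [PMF.pure_apply, hF]]
    simp
  rw [payoff, tsum_eq_single G fun F hF => by simp [posterior, PMF.pure_apply, hF]]
  simp only [posterior, hev, PMF.pure_apply, if_true, one_mul]
  rw [ENNReal.div_self hG (ne_top_of_le_ne_top ENNReal.one_ne_top (likelihood_le_one G h)),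
    one_mul]

/-- The prior concentrated on `G` is consistent with the history, and any rule `p'` bounds the
optimal payoff from below. -/
theorem performanceRatio_mul_envPayoff_le (δ : ℝ) (p p' : DecisionRule) {x₀ : ℝ}
    {𝓕 : Set (ProbabilityMeasure ℝ)} {G : ProbabilityMeasure ℝ} (hG : G ∈ 𝓕) {d : List ℝ}
    (hd : ∀ x ∈ d, (G : Measure ℝ) {x} ≠ 0) :
    performanceRatio δ p x₀ 𝓕 * envPayoff δ p' G (x₀ :: d) ≤ envPayoff δ p G (x₀ :: d) := by
  have hlik : likelihood G (x₀ :: d) ≠ 0 := by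
    simp only [likelihood, List.tail_cons, ne_eq, List.prod_eq_zero_iff, List.mem_map, not_exists,
      not_and]
    exact hd
  have hcons : PMF.pure G ∈ consistentPriors 𝓕 (x₀ :: d) := by
    refine ⟨⟨by simp, by simpa using hG⟩, pos_of_ne_zero fun h => ?_⟩
    rw [evidence, ENNReal.tsum_eq_zero] at h
    exact hlik (by simpa using h G)
  have hle : performanceRatio δ p x₀ 𝓕 ≤ payoff δ p (PMF.pure G) (x₀ :: d) /
      optimalPayoff δ (PMF.pure G) (x₀ :: d) :=
    iInf₂_le_of_le (x₀ :: d) ⟨d, rfl⟩ (iInf₂_le _ hcons)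
  rw [← payoff_pure δ p hlik, ← payoff_pure δ p' hlik]
  refine le_trans ?_ (ENNReal.mul_le_of_le_div hle)
  gcongr
  exact le_iSup (fun p => payoff δ p (PMF.pure G) (x₀ :: d)) p'

theorem performanceRatio_le_quarter {δ : ℝ} (hδ : δ ∈ Ioo (0 : ℝ) 1) (p : DecisionRule) {x₀ : ℝ}
    (hx₀ : 0 < x₀) {X : Set ℝ} (hXm : MeasurableSet X) (hX : X ⊆ Ici 0) (h0 : (0 : ℝ) ∈ X)
    (hunb : ¬ BddAbove X) : performanceRatio δ p x₀ (environments X) ≤ 1 / 4 := by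
  refine ENNReal.le_of_forall_nnreal_lt fun r hr => ?_
  have h1 : 0 < 1 - δ := sub_pos.2 hδ.2
  set H : Set (List ℝ) := {h | ∃ d : List ℝ, h = x₀ :: d ∧ ∀ x ∈ d, x ∈ X} with hHdef
  have happ : ∀ h ∈ H, ∀ x ∈ X, h ++ [x] ∈ H := by
    rintro h ⟨d, rfl, hd⟩ x hx
    refine ⟨d ++ [x], rfl, fun y hy => ?_⟩
    rcases List.mem_append.1 hy with hy | hy
    · exact hd y hy
    · rwa [List.mem_singleton.1 hy]
  have hpos : ∀ h ∈ H, 0 < bestSoFar h := by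
    rintro h ⟨d, rfl, -⟩
    exact hx₀.trans_le (le_bestSoFar List.mem_cons_self)
  have hne : (zeroRatio δ p '' H).Nonempty := ⟨_, mem_image_of_mem _ ⟨[], rfl, by simp⟩⟩
  have hbdd : BddAbove (zeroRatio δ p '' H) :=
    ⟨1, by rintro _ ⟨h, -, rfl⟩; exact zeroRatio_le_one hδ p h⟩
  set a := sSup (zeroRatio δ p '' H) with ha
  have hle : ∀ h ∈ H, zeroRatio δ p h ≤ a := fun h hh => le_csSup hbdd (mem_image_of_mem _ hh)
  have hkey : ∀ h ∈ H, ∀ q ∈ Ioo (0 : ℝ) (1 / 2), (r : ℝ) * (δ / (1 - δ + δ * q)) ≤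
      q + (a + (q + q ^ 2) * (δ / (1 - δ)) + q) * (δ * (1 - zeroRatio δ p h) / (1 - δ)) := by
    rintro h hh q ⟨hq0, hq1⟩
    -- With `z > y / q ^ 2` and `η = q ^ 2`, both the current best `y` and the component `ν`
    -- contribute `O(q ^ 2 z)`, negligible against the gain of order `q z`.
    obtain ⟨z, hzX, hz⟩ := not_bddAbove_iff.1 hunb (bestSoFar h / q ^ 2)
    rw [div_lt_iff₀ (by positivity)] at hz
    have hb := hpos h hh
    have hz0 : 0 < z := by
      by_contra hcon
      nlinarith [sq_nonneg q]
    have hq2 : q ^ 2 ≤ q := by nlinarith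
    have hbz : bestSoFar h ≤ z := by nlinarith
    have hh' := hh
    obtain ⟨d, rfl, hd⟩ := hh'
    obtain ⟨G, hGX, ⟨ν, hG⟩, hGd⟩ := exists_isSearchEnv hXm hX h0 hd hzX
      (fun x hx => (le_bestSoFar (List.mem_cons_of_mem _ hx)).trans hbz) hq0.le
      (pow_pos hq0 2) (by linarith)
    have hup := hG.toReal_envPayoff_le_of_zeroRatio_le hδ p (fun h hh => happ h hh 0 h0)
      (fun h hh => happ h hh z hzX) hpos hle hh hbz
    have hmul : ENNReal.ofReal (r * (δ * q * z / (1 - δ + δ * q))) ≤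
        envPayoff δ p G (x₀ :: d) := by
      rw [ENNReal.ofReal_mul r.coe_nonneg, ENNReal.ofReal_coe_nnreal]
      refine le_trans (mul_le_mul' hr.le (hG.le_envPayoff_thresholdRule hδ (x₀ :: d))) ?_
      exact performanceRatio_mul_envPayoff_le δ p _ hGX hGd
    have hreal := ((ENNReal.ofReal_le_iff_le_toReal (hG.envPayoff_ne_top hδ p hbz)).1 hmul).trans
      hup
    refine le_of_mul_le_mul_right ?_ (mul_pos hq0 hz0)
    calc (r : ℝ) * (δ / (1 - δ + δ * q)) * (q * z) = r * (δ * q * z / (1 - δ + δ * q)) := by ring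
      _ ≤ _ := hreal
      _ ≤ z * q ^ 2 + (q * (z * (a + (q + q ^ 2) * (δ / (1 - δ)))) + q ^ 2 * z) *
          (δ * (1 - zeroRatio δ p (x₀ :: d)) / (1 - δ)) := by linarith
      _ = _ := by ring
  -- Let `q` tend to `0` from above in `hkey`; the common factor `δ / (1 - δ)` cancels.
  have hlim : ∀ h ∈ H, (r : ℝ) ≤ a * (1 - zeroRatio δ p h) := by
    intro h hh
    have hev : ∀ᶠ q in nhdsWithin (0 : ℝ) (Ioi 0), q ∈ Ioo (0 : ℝ) (1 / 2) :=
      Ioo_mem_nhdsGT (by norm_num)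
    have hL : Filter.Tendsto (fun q : ℝ => (r : ℝ) * (δ / (1 - δ + δ * q)))
        (nhdsWithin 0 (Ioi 0)) (nhds ((r : ℝ) * (δ / (1 - δ + δ * 0)))) := by
      refine tendsto_nhdsWithin_of_tendsto_nhds (ContinuousAt.tendsto ?_)
      refine continuousAt_const.mul (continuousAt_const.div (by fun_prop) ?_)
      simpa using h1.ne'
    have hR : Filter.Tendsto (fun q : ℝ => q + (a + (q + q ^ 2) * (δ / (1 - δ)) + q) *
        (δ * (1 - zeroRatio δ p h) / (1 - δ))) (nhdsWithin 0 (Ioi 0))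
        (nhds (0 + (a + (0 + 0 ^ 2) * (δ / (1 - δ)) + 0) *
          (δ * (1 - zeroRatio δ p h) / (1 - δ)))) :=
      tendsto_nhdsWithin_of_tendsto_nhds (Continuous.tendsto (by fun_prop) 0)
    have := le_of_tendsto_of_tendsto hL hR (hev.mono fun q hq => hkey h hh q hq)
    refine le_of_mul_le_mul_right ?_ (div_pos hδ.1 h1)
    calc (r : ℝ) * (δ / (1 - δ)) = (r : ℝ) * (δ / (1 - δ + δ * 0)) := by simp
      _ ≤ _ := this
      _ = _ := by ring
  have ha0 : 0 ≤ a := by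
    obtain ⟨_, h, hh, rfl⟩ := hne
    exact (zeroRatio_nonneg δ p h).trans (hle h hh)
  -- For `a > 0`, every `zeroRatio` is at most `(a - r) / a`, hence so is their supremum `a`.
  have hsq : a * a ≤ a - r := by
    rcases ha0.eq_or_lt with ha0 | ha0
    · obtain ⟨_, h, hh, rfl⟩ := hne
      have := hlim h hh
      rw [← ha0] at this ⊢
      linarith
    · rw [← le_div_iff₀ ha0]
      refine csSup_le hne ?_
      rintro _ ⟨h, hh, rfl⟩
      rw [le_div_iff₀ ha0]
      linarith [hlim h hh]
  have hr4 : (r : ℝ) ≤ 1 / 4 := by nlinarith [sq_nonneg (a - 1 / 2)]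
  calc (r : ℝ≥0∞) = ENNReal.ofReal r := by simp
    _ ≤ ENNReal.ofReal (1 / 4) := ENNReal.ofReal_le_ofReal hr4
    _ = 1 / 4 := by
      rw [ENNReal.ofReal_div_of_pos (by norm_num)]
      norm_num

end

theorem theorem2 (δ : ℝ) (hδ : δ ∈ Ioo (0 : ℝ) 1) (x₀ : ℝ) (hx₀ : 0 < x₀)
    (X : Set ℝ) (hXm : MeasurableSet X) (hX : X ⊆ Ici 0) (h0 : (0 : ℝ) ∈ X) :
    1 / 4 ≤ performanceRatio δ (constantRule ((1 - δ) / (2 - δ)) (quarterProb_mem hδ)) x₀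
        (environments X) ∧
      (¬ BddAbove X →
        IsDynamicallyRobust δ (constantRule ((1 - δ) / (2 - δ)) (quarterProb_mem hδ)) x₀
            (environments X) ∧
          robustRatio δ x₀ (environments X) = 1 / 4) := by
  have hlow := quarter_le_performanceRatio hδ hx₀ hX
  refine ⟨hlow, fun hunb => ?_⟩
  have hrob : robustRatio δ x₀ (environments X) = 1 / 4 :=
    le_antisymm (iSup_le fun p => performanceRatio_le_quarter hδ p hx₀ hXm hX h0 hunb)
      (hlow.trans (le_iSup (fun p => performanceRatio δ p x₀ (environments X)) _))
  exact ⟨le_antisymm (le_iSup (fun p => performanceRatio δ p x₀ (environments X)) _)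
    (hrob.le.trans hlow), hrob⟩
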